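/- For a real number $x>0$ let $D(x)\in\{1,\dots,9\}$ be its leading decimal digit, i.e. $D(x)=d$ if and only if $d\cdot 10^i\le x<(d+1)\cdot 10^i$ for some $i\in\mathbb Z$. Let $a>0$ be a real number such that $\log_{10}a$ is irrational, and let $d\in\{1,\dots,9\}$. For integers $N\ge 1$ put $$S_d(N)=\#\{1\le n\le N: D(a^n)=d\},\qquad B_d(N)=N\log_{10}\Bigl(1+\frac1d\Bigr),\qquad E_d(N)=S_d(N)-B_d(N).$$ The Benford prediction for the leading digit $d$ in $\{a^n\}$ is said to have *bounded error* if there is a constant $C$ with $|E_d(N)|\le C$ for all $N\ge1$; it is a *lower perfect hit* if $S_d(N)=\lfloor B_d(N)\rfloor$ for all $N\ge1$, and an *upper perfect hit* if $S_d(N)=\lceil B_d(N)\rceil$ for all $N\ge1$. We say that $E_d$ has a limit distribution with probability density $f$ if, for all real numbers $s<t$, $$\lim_{N\to\infty}\frac1N\#\{1\le n\le N: s\le E_d(n)<t\}=\int_s^t f(x)\,dx .$$ **Theorem (Perfect Hits and Bounded Benford Errors).** (i) The Benford prediction for the leading digit $d$ in $\{a^n\}$ has bounded error if and only if $$a^k=\frac{d+1}{d}\,10^m\quad\text{for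 some }k\in\mathbb Z\setminus\{0\}\text{ and }m\in\mathbb Z.\qquad(*)$$ Moreover, if $(*)$ holds with $k\in\mathbb Z\setminus\{0\}$ and $m\in\mathbb Z$, then $E_d$ has a limit distribution whose density is a weighted average of the densities of $|k|$ uniform distributions, i.e. it has the form $\sum_{i=1}^{|k|}w_i\,\frac{1}{q_i-p_i}\mathbf 1_{[p_i,q_i]}$ with weights $w_i>0$, $\sum_i w_i=1$, and real numbers $p_i<q_i$. (ii) The Benford prediction for the leading digit $d$ in $\{a^n\}$ is a lower perfect hit if and only if $d=1$ and $a=2\cdot10^m$ for some $m\in\mathbb Z$, and it is an upper perfect hit if and only if $d=9$ and $a=9\cdot10^m$ for some $m\in\mathbb Z$. Moreover, $E_d$ has a limit distribution in both of these cases: it is the uniform distribution on $[-1,0]$ in the first case, and the uniform distribution on $[0,1]$ in the second case. -/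

import Mathlib

open MeasureTheory Filter Topology

noncomputable section

/-- The leading (most significant) decimal digit of a positive real number `x`.
Here `Int.log 10 x` is the greatest integer `i` with `10 ^ i ≤ x`. -/
def leadingDigit (x : ℝ) : ℕ := ⌊x / (10 : ℝ) ^ (Int.log 10 x)⌋₊

/-- The leading digit counting function `S_d(N, {u n}) = #{1 ≤ n ≤ N : D(u n) = d}`. -/
def leadingDigitCount (d : ℕ) (u : ℕ → ℝ) (N : ℕ) : ℕ :=
  ((Finset.Icc 1 N).filter (fun n => leadingDigit (u n) = d)).card

/-- The Benford prediction `B_d(N) = N log₁₀ (1 + 1 / d)`. -/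
def benfordPrediction (d N : ℕ) : ℝ := (N : ℝ) * Real.logb 10 (1 + 1 / (d : ℝ))

/-- The Benford error `E_d(N, {u n}) = S_d(N, {u n}) - B_d(N)`. -/
def benfordError (d : ℕ) (u : ℕ → ℝ) (N : ℕ) : ℝ :=
  (leadingDigitCount d u N : ℝ) - benfordPrediction d N

/-- The Benford prediction for the digit `d` in `{u n}` is a lower perfect hit. -/
def IsLowerPerfectHit (d : ℕ) (u : ℕ → ℝ) : Prop :=
  ∀ N : ℕ, 1 ≤ N → (leadingDigitCount d u N : ℤ) = ⌊benfordPrediction d N⌋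

/-- The Benford prediction for the digit `d` in `{u n}` is an upper perfect hit. -/
def IsUpperPerfectHit (d : ℕ) (u : ℕ → ℝ) : Prop :=
  ∀ N : ℕ, 1 ≤ N → (leadingDigitCount d u N : ℤ) = ⌈benfordPrediction d N⌉

/-- The Benford prediction for the digit `d` in `{u n}` has bounded error. -/
def HasBoundedBenfordError (d : ℕ) (u : ℕ → ℝ) : Prop :=
  ∃ C : ℝ, ∀ N : ℕ, 1 ≤ N → |(leadingDigitCount d u N : ℝ) - benfordPrediction d N| ≤ C

/-- The sequence `x 1, x 2, …` has a limit distribution with probability density `f`: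
for all `s < t`, the proportion of `n ≤ N` with `s ≤ x n < t` tends to `∫ x in s..t, f x`. -/
structure HasLimitDensity (x : ℕ → ℝ) (f : ℝ → ℝ) : Prop where
  nonneg : ∀ y, 0 ≤ f y
  integrable : Integrable f
  integral_eq_one : ∫ y, f y = 1
  tendsto : ∀ s t : ℝ, s < t →
    Tendsto
      (fun N : ℕ =>
        (((Finset.Icc 1 N).filter (fun n => s ≤ x n ∧ x n < t)).card : ℝ) / (N : ℝ))
      atTop (𝓝 (∫ y in s..t, f y))

/-- The density of the uniform distribution on the interval `[p, q]` (for `p < q`). -/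
def uniformDensity (p q : ℝ) : ℝ → ℝ :=
  (Set.Icc p q).indicator (fun _ => 1 / (q - p))

/-- `f` is a weighted average, with positive weights of sum `1`, of the densities of `r`
uniform distributions on nondegenerate bounded intervals. -/
def IsUniformMixture (r : ℕ) (f : ℝ → ℝ) : Prop :=
  ∃ w p q : Fin r → ℝ,
    (∀ i, 0 < w i) ∧ ∑ i, w i = 1 ∧ (∀ i, p i < q i) ∧
      ∀ y, f y = ∑ i, w i * uniformDensity (p i) (q i) y

end

/-! ### Fractional parts and the leading digit -/

/-! Put `α = log₁₀ a`, `L = log₁₀ (1 + 1/d)`, `b = log₁₀ d`. Then `E_d(N)` is the discrepancy of the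
rotation orbit `nα - b` for the arc `[0, L)` mod 1 (`benfordError_pow`), whose indicator is `L + {y
- L} - {y}`.

If `kα = L + m`, subtracting `L` inside the fractional part is a shift of the orbit by `k` steps, so
the sum telescopes to a constant plus or minus `|k|` sawtooth terms `{Nα - b_j}` and is bounded. The
`b_j` cut the circle into arcs. On each arc the sum of sawtooths is affine, so equidistribution
yields one uniform law per arc, weighted by its length (`Irrational.hasLimitDensity_sawtooth`).

Conversely (Kesten), boundedness along one orbit spreads to all orbits. The limsup of the
discrepancy sums is then a transfer function `g`, and `exp(2πig)` is an eigenfunction of the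
rotation with eigenvalue `exp(2πiL)`; Fourier analysis forces `L ∈ ℤα + ℤ`.

A perfect hit confines the error to a half-open interval of length one. Irrational gaps between the
`b_j` make some arc longer than `1/|k|` when `|k| > 1`, so `k = ±1` (`Irrational.natAbs_eq_one`).
The sign of the single remaining sawtooth and its additive constant then determine `d`. -/

theorem Int.fract_eq_of_sub_eq {x y : ℝ} (h0 : 0 ≤ y) (h1 : y < 1) (z : ℤ) (h : x - y = z) :
    Int.fract x = y :=
  Int.fract_eq_iff.2 ⟨h0, h1, z, h⟩

/-- The indicator of `[0, L)` modulo one, in terms of the sawtooth function. -/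
theorem ite_fract_lt {L : ℝ} (hL0 : 0 ≤ L) (hL1 : L ≤ 1) (y : ℝ) :
    (if Int.fract y < L then (1 : ℝ) else 0) = L + Int.fract (y - L) - Int.fract y := by
  have h0 := Int.fract_nonneg y
  have h1 := Int.fract_lt_one y
  have h2 := Int.self_sub_fract y
  split_ifs with h
  · rw [Int.fract_eq_of_sub_eq (x := y - L) (y := Int.fract y - L + 1) (by linarith) (by linarith)
      (⌊y⌋ - 1) (by push_cast; linarith)]
    ring
  · rw [Int.fract_eq_of_sub_eq (x := y - L) (y := Int.fract y - L) (by linarith) (by linarith)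
      ⌊y⌋ (by linarith)]
    ring

theorem le_fract_and_fract_lt_iff {β L : ℝ} (hβ : 0 ≤ β) (hL : 0 ≤ L) (h : β + L ≤ 1) (x : ℝ) :
    (β ≤ Int.fract x ∧ Int.fract x < β + L) ↔ Int.fract (x - β) < L := by
  have h0 := Int.fract_nonneg x
  have h1 := Int.fract_lt_one x
  have h2 := Int.self_sub_fract x
  by_cases hx : β ≤ Int.fract x
  · rw [Int.fract_eq_of_sub_eq (x := x - β) (y := Int.fract x - β) (by linarith) (by linarith)
      ⌊x⌋ (by linarith)]
    constructor
    · rintro ⟨-, h⟩; linarith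
    · intro h; exact ⟨hx, by linarith⟩
  · rw [Int.fract_eq_of_sub_eq (x := x - β) (y := Int.fract x - β + 1) (by linarith) (by linarith)
      (⌊x⌋ - 1) (by push_cast; linarith)]
    constructor
    · rintro ⟨h, -⟩; exact absurd h hx
    · intro h; linarith

theorem logb_ten_zpow (x : ℝ) (n : ℤ) : Real.logb 10 (x ^ n) = n * Real.logb 10 x := by
  rw [Real.logb, Real.log_zpow, Real.logb, mul_div_assoc]

theorem logb_ten_ten_zpow (n : ℤ) : Real.logb 10 ((10 : ℝ) ^ n) = n := by
  rw [logb_ten_zpow, Real.logb_self_eq_one (by norm_num), mul_one]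

theorem leadingDigit_eq_iff {x : ℝ} (hx : 0 < x) {d : ℕ} (hd1 : 1 ≤ d) :
    leadingDigit x = d ↔ Real.logb 10 d ≤ Int.fract (Real.logb 10 x) ∧
      Int.fract (Real.logb 10 x) < Real.logb 10 (d + 1) := by
  have hi : Int.log 10 x = ⌊Real.logb 10 x⌋ := by
    have := Real.floor_logb_natCast (b := 10) hx.le
    push_cast at this
    exact this.symm
  have hp : (0 : ℝ) < (10 : ℝ) ^ Int.log 10 x := by positivity
  have hy : 0 < x / (10 : ℝ) ^ Int.log 10 x := by positivity
  have hlog : Real.logb 10 (x / (10 : ℝ) ^ Int.log 10 x) = Int.fract (Real.logb 10 x) := by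
    rw [Real.logb_div hx.ne' hp.ne', logb_ten_ten_zpow, hi, Int.fract]
  have hd : (0 : ℝ) < d := by exact_mod_cast hd1
  unfold leadingDigit
  rw [Nat.floor_eq_iff hy.le, ← hlog, Real.logb_le_logb (by norm_num) hd hy,
    Real.logb_lt_logb_iff (by norm_num) hy (by positivity)]

/-- The prediction `log₁₀ (1 + 1 / d)` is the length of `[log₁₀ d, log₁₀ (d + 1))`. -/
theorem logb_add_logb_one_add {d : ℕ} (hd1 : 1 ≤ d) :
    Real.logb 10 d + Real.logb 10 (1 + 1 / (d : ℝ)) = Real.logb 10 (d + 1) := by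
  have hd : (0 : ℝ) < d := by exact_mod_cast hd1
  rw [← Real.logb_mul hd.ne' (by positivity)]
  congr 1
  field_simp

theorem logb_one_add_pos {d : ℕ} (hd1 : 1 ≤ d) : 0 < Real.logb 10 (1 + 1 / (d : ℝ)) := by
  have hd : (0 : ℝ) < d := by exact_mod_cast hd1
  exact Real.logb_pos (by norm_num) (by simp [hd])

theorem logb_natCast_nonneg {d : ℕ} (hd1 : 1 ≤ d) : 0 ≤ Real.logb 10 (d : ℝ) :=
  Real.logb_nonneg (by norm_num) (by exact_mod_cast hd1)

theorem logb_natCast_add_one_le_one {d : ℕ} (hd9 : d ≤ 9) : Real.logb 10 ((d : ℝ) + 1) ≤ 1 := by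
  rw [Real.logb_le_iff_le_rpow (by norm_num) (by positivity), Real.rpow_one]
  have : (d : ℝ) ≤ 9 := by exact_mod_cast hd9
  linarith

theorem logb_one_add_le_one {d : ℕ} (hd1 : 1 ≤ d) (hd9 : d ≤ 9) :
    Real.logb 10 (1 + 1 / (d : ℝ)) ≤ 1 := by
  linarith [logb_add_logb_one_add hd1, logb_natCast_nonneg hd1, logb_natCast_add_one_le_one hd9]

theorem leadingDigit_pow_eq_iff {a : ℝ} (ha : 0 < a) {d : ℕ} (hd1 : 1 ≤ d) (hd9 : d ≤ 9) (n : ℕ) :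
    leadingDigit (a ^ n) = d ↔ Int.fract (n * Real.logb 10 a - Real.logb 10 d) <
      Real.logb 10 (1 + 1 / (d : ℝ)) := by
  rw [leadingDigit_eq_iff (pow_pos ha n) hd1, Real.logb_pow, ← logb_add_logb_one_add hd1]
  exact le_fract_and_fract_lt_iff (logb_natCast_nonneg hd1) (logb_one_add_pos hd1).le
    (by linarith [logb_add_logb_one_add hd1, logb_natCast_add_one_le_one hd9]) _

/-- The discrepancy of the points `n α - b`, `1 ≤ n ≤ N`, for the interval `[0, L)` mod `1`. -/
noncomputable def rotationDiscrepancy (α b L : ℝ) (N : ℕ) : ℝ :=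
  ∑ n ∈ Finset.Icc 1 N, ((if Int.fract (n * α - b) < L then (1 : ℝ) else 0) - L)

theorem benfordError_pow {a : ℝ} (ha : 0 < a) {d : ℕ} (hd1 : 1 ≤ d) (hd9 : d ≤ 9) (N : ℕ) :
    benfordError d (fun n => a ^ n) N = rotationDiscrepancy (Real.logb 10 a) (Real.logb 10 d)
      (Real.logb 10 (1 + 1 / (d : ℝ))) N := by
  unfold benfordError rotationDiscrepancy leadingDigitCount benfordPrediction
  simp only [leadingDigit_pow_eq_iff ha hd1 hd9]
  rw [Finset.sum_sub_distrib, Finset.sum_boole]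
  simp

/-! ### Telescoping -/

/-- Raising `N` by one changes the right side by a sum that itself telescopes in `j`. The domain is
`ℤ` because the shift reaches nonpositive indices. -/
theorem sum_sub_shift (ψ : ℤ → ℝ) (r N : ℕ) :
    ∑ n ∈ Finset.Icc 1 N, (ψ (n - r) - ψ n) =
      ∑ j ∈ Finset.range r, (ψ (-j) - ψ (N - j)) := by
  induction N with
  | zero => simp
  | succ N ih =>
    rw [Finset.sum_Icc_succ_top (by lia), ih, ← sub_eq_zero]
    have h := Finset.sum_range_sub (fun j : ℕ => ψ (N + 1 - j)) r
    have h2 : ∑ j ∈ Finset.range r, (ψ (N + 1 - (j + 1 : ℕ)) - ψ (N + 1 - j)) =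
        ∑ j ∈ Finset.range r, (ψ (-j) - ψ ((N + 1 : ℕ) - j)) -
        ∑ j ∈ Finset.range r, (ψ (-j) - ψ (N - j)) := by
      rw [← Finset.sum_sub_distrib]
      refine Finset.sum_congr rfl fun j _ => ?_
      rw [show (N : ℤ) + 1 - (j + 1 : ℕ) = N - j by push_cast; ring]
      push_cast; ring
    rw [h] at h2
    push_cast at h2 ⊢
    simp only [sub_zero] at h2
    linarith

theorem sum_shift_sub (ψ : ℤ → ℝ) (r N : ℕ) :
    ∑ n ∈ Finset.Icc 1 N, (ψ (n + r) - ψ n) =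
      ∑ j ∈ Finset.range r, (ψ (N + (j + 1)) - ψ (j + 1)) := by
  induction N with
  | zero => simp
  | succ N ih =>
    rw [Finset.sum_Icc_succ_top (by lia), ih]
    have h := Finset.sum_range_sub (fun j : ℕ => ψ (N + 1 + j)) r
    have h2 : ∑ j ∈ Finset.range r, (ψ (N + 1 + (j + 1 : ℕ)) - ψ (N + 1 + j)) =
        ∑ j ∈ Finset.range r, (ψ ((N + 1 : ℕ) + (j + 1)) - ψ (j + 1)) -
        ∑ j ∈ Finset.range r, (ψ (N + (j + 1)) - ψ (j + 1)) := by
      rw [← Finset.sum_sub_distrib]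
      refine Finset.sum_congr rfl fun j _ => ?_
      rw [show (N : ℤ) + 1 + j = N + (j + 1) by ring]
      push_cast; ring
    rw [h] at h2
    push_cast at h2 ⊢
    simp only [add_zero] at h2
    linarith

/-- Modulo one `L` equals `rα`, so in `ite_fract_lt` the term `{y - L}` is the sawtooth `r` steps
earlier on the orbit. -/
theorem rotationDiscrepancy_of_pos {α b L : ℝ} (hL0 : 0 ≤ L) (hL1 : L ≤ 1) {r : ℕ} {m : ℤ}
    (h : r * α = L + m) (N : ℕ) :
    rotationDiscrepancy α b L N = ∑ j ∈ Finset.range r,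
      (Int.fract (-j * α - b) - Int.fract (N * α - (b + j * α))) := by
  unfold rotationDiscrepancy
  have key := sum_sub_shift (fun n => Int.fract (n * α - b)) r N
  refine Eq.trans (Finset.sum_congr rfl fun n _ => ?_)
    (key.trans (Finset.sum_congr rfl fun j _ => ?_))
  · rw [ite_fract_lt hL0 hL1, ← Int.fract_add_intCast _ (-m)]
    push_cast
    rw [show (n * α - b - L + -m : ℝ) = (n - r) * α - b by linarith]
    ring
  · push_cast
    ring_nf

theorem rotationDiscrepancy_of_neg {α b L : ℝ} (hL0 : 0 ≤ L) (hL1 : L ≤ 1) {r : ℕ} {m : ℤ}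
    (h : -r * α = L + m) (N : ℕ) :
    rotationDiscrepancy α b L N = ∑ j ∈ Finset.range r,
      (Int.fract (N * α - (b - (j + 1) * α)) - Int.fract ((j + 1) * α - b)) := by
  unfold rotationDiscrepancy
  have key := sum_shift_sub (fun n => Int.fract (n * α - b)) r N
  refine Eq.trans (Finset.sum_congr rfl fun n _ => ?_)
    (key.trans (Finset.sum_congr rfl fun j _ => ?_))
  · rw [ite_fract_lt hL0 hL1, ← Int.fract_add_intCast _ (-m)]
    push_cast
    rw [show (n * α - b - L + -m : ℝ) = (n + r) * α - b by linarith]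
    ring
  · push_cast
    ring_nf

theorem abs_rotationDiscrepancy_le {α b L : ℝ} (hL0 : 0 ≤ L) (hL1 : L ≤ 1) {k m : ℤ}
    (h : k * α = L + m) (N : ℕ) : |rotationDiscrepancy α b L N| ≤ k.natAbs := by
  have aux : ∀ (r : ℕ) (f g : ℕ → ℝ), |∑ j ∈ Finset.range r,
      (Int.fract (f j) - Int.fract (g j))| ≤ r := fun r f g => by
    refine (Finset.abs_sum_le_sum_abs _ _).trans ((Finset.sum_le_card_nsmul _ _ 1 ?_).trans ?_)
    · intro j _
      rw [abs_le]
      constructor <;> linarith [Int.fract_nonneg (f j), Int.fract_nonneg (g j),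
        Int.fract_lt_one (f j), Int.fract_lt_one (g j)]
    · simp
  obtain ⟨r, rfl | rfl⟩ := k.eq_nat_or_neg
  · rw [rotationDiscrepancy_of_pos hL0 hL1 (r := r) (m := m) (by exact_mod_cast h)]
    simpa using aux r _ _
  · rw [rotationDiscrepancy_of_neg hL0 hL1 (r := r) (m := m) (by exact_mod_cast h)]
    simpa using aux r _ _

/-! ### Equidistribution of irrational rotations -/

/-- The set `A` of positive integers has natural density `c`. -/
def HasFrequency (A : Set ℕ) (c : ℝ) : Prop :=
  Tendsto (fun N : ℕ => (∑ n ∈ Finset.Icc 1 N, A.indicator (fun _ => (1 : ℝ)) n) / (N : ℝ))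
    atTop (𝓝 c)

theorem HasFrequency.sub {A B : Set ℕ} {x y : ℝ} (hAB : Disjoint A B)
    (hA : HasFrequency A x) (hB : HasFrequency (A ∪ B) y) : HasFrequency B (y - x) := by
  refine (Tendsto.sub hB hA).congr fun N => ?_
  rw [← sub_div, ← Finset.sum_sub_distrib]
  simp [Set.indicator_union_of_disjoint hAB]

theorem HasFrequency.iUnion {ι : Type*} [Fintype ι] {A : ι → Set ℕ} {x : ι → ℝ}
    (hA : Pairwise fun i j => Disjoint (A i) (A j)) (h : ∀ i, HasFrequency (A i) (x i)) :
    HasFrequency (⋃ i, A i) (∑ i, x i) := by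
  refine (tendsto_finsetSum Finset.univ fun i _ => h i).congr fun N => ?_
  rw [← Finset.sum_div, Finset.sum_comm]
  congr 1
  refine Finset.sum_congr rfl fun n _ => ?_
  have := Finset.indicator_biUnion_apply Finset.univ A (f := fun _ : ℕ => (1 : ℝ))
    (fun i _ j _ hij => hA hij) n
  simpa using this.symm

theorem hasFrequency_univ : HasFrequency Set.univ 1 := by
  refine tendsto_const_nhds.congr' ?_
  filter_upwards [eventually_gt_atTop 0] with N hN
  have : (N : ℝ) ≠ 0 := by positivity
  simp [this]

theorem HasFrequency.nonempty {A : Set ℕ} {x : ℝ} (h : HasFrequency A x) (hx : x ≠ 0) :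
    A.Nonempty := by
  by_contra hA
  rw [Set.not_nonempty_iff_eq_empty] at hA
  subst hA
  have : HasFrequency ∅ 0 := by simp [HasFrequency]
  exact hx (tendsto_nhds_unique h this)

theorem HasFrequency.unique {A : Set ℕ} {x y : ℝ} (h : HasFrequency A x) (h' : HasFrequency A y) :
    x = y := tendsto_nhds_unique h h'

theorem Irrational.exists_intCast_mul_sub_mem_Ioo {α : ℝ} (hα : Irrational α) {p q : ℝ}
    (hpq : p < q) : ∃ k m : ℤ, p < k * α - m ∧ k * α - m < q := by
  have hd : Dense (AddSubgroup.closure {α, (1 : ℝ)} : Set ℝ) := by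
    rw [dense_addSubgroupClosure_pair_iff]; simpa using hα
  obtain ⟨x, hx, hx1, hx2⟩ := hd.exists_between hpq
  obtain ⟨k, m, rfl⟩ := AddSubgroup.mem_closure_pair.1 hx
  refine ⟨k, -m, ?_⟩
  push_cast
  simp only [zsmul_eq_mul, mul_one] at hx1 hx2
  constructor <;> linarith

/-- For these special lengths equidistribution needs no Weyl sums: the discrepancy is bounded, so it
vanishes after division by `N`. -/
theorem hasFrequency_fract_lt_of_mem {α b L : ℝ} (hL0 : 0 ≤ L) (hL1 : L ≤ 1) {k m : ℤ}
    (h : k * α = L + m) : HasFrequency {n | Int.fract (n * α - b) < L} L := by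
  have h1 : Tendsto (fun N : ℕ => rotationDiscrepancy α b L N / N) atTop (𝓝 0) :=
    tendsto_bdd_div_atTop_nhds_zero (b := -k.natAbs) (B := k.natAbs)
      (.of_forall fun N => (abs_le.1 (abs_rotationDiscrepancy_le hL0 hL1 h N)).1)
      (.of_forall fun N => (abs_le.1 (abs_rotationDiscrepancy_le hL0 hL1 h N)).2)
      tendsto_natCast_atTop_atTop
  have h2 := h1.add_const L
  rw [zero_add] at h2
  refine h2.congr' ?_
  filter_upwards [eventually_gt_atTop 0] with N hN
  have : (N : ℝ) ≠ 0 := by positivity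
  simp only [rotationDiscrepancy, Finset.sum_sub_distrib, Set.indicator_apply, Set.mem_ofPred_eq]
  simp only [Finset.sum_const, Nat.card_Icc, add_tsub_cancel_right, nsmul_eq_mul]
  rw [sub_div, mul_div_cancel_left₀ _ this, sub_add_cancel]

theorem sum_indicator_mono {A B : Set ℕ} (h : A ⊆ B) (N : ℕ) :
    (∑ n ∈ Finset.Icc 1 N, A.indicator (fun _ => (1 : ℝ)) n) / (N : ℝ) ≤
      (∑ n ∈ Finset.Icc 1 N, B.indicator (fun _ => (1 : ℝ)) n) / (N : ℝ) := by
  gcongr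

/-- Sandwich between arcs with lengths in `ℤα + ℤ`, which is dense. The two hypotheses leave
membership at the endpoint `r` free, so open and closed variants are covered together. -/
theorem Irrational.hasFrequency_initial {α : ℝ} (hα : Irrational α) {b r : ℝ} (hr0 : 0 ≤ r)
    (hr1 : r ≤ 1) {A : Set ℕ} (h1 : ∀ n : ℕ, Int.fract (n * α - b) < r → n ∈ A)
    (h2 : ∀ n ∈ A, Int.fract (n * α - b) ≤ r) : HasFrequency A r := by
  refine tendsto_order.2 ⟨fun c hc => ?_, fun c hc => ?_⟩
  · rcases lt_or_ge c 0 with hc0 | hc0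
    · refine .of_forall fun N => hc0.trans_le ?_
      exact div_nonneg (Finset.sum_nonneg fun n _ => Set.indicator_nonneg (by simp) n) (by simp)
    · obtain ⟨k, m, hk1, hk2⟩ := hα.exists_intCast_mul_sub_mem_Ioo hc
      have := hasFrequency_fract_lt_of_mem (α := α) (b := b) (L := k * α - m) (by linarith) (by linarith)
        (k := k) (m := m) (by ring)
      filter_upwards [this.eventually_const_lt hk1] with N hN
      refine hN.trans_le (sum_indicator_mono (fun n hn => h1 n ?_) N)
      exact lt_trans hn hk2
  · rcases lt_or_ge 1 c with hc1 | hc1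
    · filter_upwards [hasFrequency_univ.eventually_lt_const hc1] with N hN
      exact (sum_indicator_mono (Set.subset_univ A) N).trans_lt hN
    · obtain ⟨k, m, hk1, hk2⟩ := hα.exists_intCast_mul_sub_mem_Ioo hc
      have := hasFrequency_fract_lt_of_mem (α := α) (b := b) (L := k * α - m) (by linarith) (by linarith)
        (k := k) (m := m) (by ring)
      filter_upwards [this.eventually_lt_const hk2] with N hN
      refine (sum_indicator_mono (fun n hn => ?_) N).trans_lt hN
      exact lt_of_le_of_lt (h2 n hn) hk1

/-- Irrational rotations are equidistributed. -/
theorem Irrational.hasFrequency_of_interval {α : ℝ} (hα : Irrational α) {b p q : ℝ} (hp : 0 ≤ p)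
    (hpq : p ≤ q) (hq : q ≤ 1) {A : Set ℕ}
    (h1 : ∀ n : ℕ, p < Int.fract (n * α - b) → Int.fract (n * α - b) < q → n ∈ A)
    (h2 : ∀ n ∈ A, p ≤ Int.fract (n * α - b) ∧ Int.fract (n * α - b) ≤ q) :
    HasFrequency A (q - p) := by
  -- Initial arcs are subtracted; removing `A` keeps the union disjoint, since `A` may contain
  -- indices landing exactly on `p`.
  let B : Set ℕ := {n | Int.fract (n * α - b) ≤ p ∧ n ∉ A}
  refine HasFrequency.sub (A := B) ?_ ?_ ?_
  · exact Set.disjoint_left.2 fun n hn hA => hn.2 hA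
  · refine hα.hasFrequency_initial (b := b) hp (hpq.trans hq) (fun n hn => ⟨hn.le, fun hA => ?_⟩)
      fun n hn => hn.1
    exact absurd (h2 n hA).1 (not_le.2 hn)
  · refine hα.hasFrequency_initial (b := b) (hp.trans hpq) hq (fun n hn => ?_) fun n hn => ?_
    · by_cases hA : n ∈ A
      · exact Or.inr hA
      · refine Or.inl ⟨?_, hA⟩
        by_contra hc
        exact hA (h1 n (not_le.1 hc) hn)
    · rcases hn with hn | hn
      · exact hn.1.trans hpq
      · exact (h2 n hn).2

theorem Irrational.exists_fract_mem_Ioo {α : ℝ} (hα : Irrational α) (b : ℝ) {p q : ℝ} (hp : 0 ≤ p)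
    (hpq : p < q) (hq : q ≤ 1) :
    ∃ n : ℕ, p < Int.fract (n * α - b) ∧ Int.fract (n * α - b) < q :=
  (hα.hasFrequency_of_interval (b := b) hp hpq.le hq
    (A := {n : ℕ | p < Int.fract (n * α - b) ∧ Int.fract (n * α - b) < q})
    (fun _ h1 h2 => ⟨h1, h2⟩) fun _ hn => ⟨hn.1.le, hn.2.le⟩).nonempty (sub_pos.2 hpq).ne'

/-! ### Uniform densities and their mixtures -/

theorem uniformDensity_nonneg {p q : ℝ} (h : p < q) (y : ℝ) : 0 ≤ uniformDensity p q y :=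
  Set.indicator_nonneg (fun _ _ => by have := sub_pos.2 h; positivity) y

theorem integrable_uniformDensity (p q : ℝ) : Integrable (uniformDensity p q) :=
  (integrable_indicator_iff measurableSet_Icc).2 (by simp)

theorem integral_uniformDensity {p q : ℝ} (h : p < q) : ∫ y, uniformDensity p q y = 1 := by
  rw [uniformDensity, integral_indicator measurableSet_Icc]
  have := (sub_pos.2 h).ne'
  simp [h.le, this]

theorem intervalIntegral_uniformDensity {p q s t : ℝ} (h : p < q) (hst : s ≤ t) :
    ∫ y in s..t, uniformDensity p q y =
      (max p (min q t) - max p (min q s)) / (q - p) := by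
  rw [intervalIntegral.integral_of_le hst, ← integral_Icc_eq_integral_Ioc, uniformDensity,
    setIntegral_indicator measurableSet_Icc, Set.Icc_inter_Icc]
  simp only [integral_const, measureReal_restrict_apply_univ, Real.volume_real_Icc, smul_eq_mul]
  rw [mul_one_div]
  congr 1
  grind

theorem IsUniformMixture.hasLimitDensity {r : ℕ} {w p q : Fin r → ℝ} (hw : ∀ i, 0 < w i)
    (hw1 : ∑ i, w i = 1) (hpq : ∀ i, p i < q i) {x : ℕ → ℝ}
    (h : ∀ s t : ℝ, s < t → HasFrequency {n | s ≤ x n ∧ x n < t}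
      (∑ i, w i * ∫ y in s..t, uniformDensity (p i) (q i) y)) :
    HasLimitDensity x (fun y => ∑ i, w i * uniformDensity (p i) (q i) y) where
  nonneg y := Finset.sum_nonneg fun i _ => mul_nonneg (hw i).le (uniformDensity_nonneg (hpq i) y)
  integrable := integrable_finsetSum _ fun i _ => (integrable_uniformDensity _ _).const_mul _
  integral_eq_one := by
    rw [integral_finsetSum _ fun i _ => (integrable_uniformDensity _ _).const_mul _]
    simp [integral_const_mul, integral_uniformDensity, hpq, hw1]
  tendsto s t hst := by
    rw [intervalIntegral.integral_finsetSum fun i _ =>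
      ((integrable_uniformDensity _ _).const_mul _).intervalIntegrable]
    simp only [intervalIntegral.integral_const_mul]
    refine (h s t hst).congr fun N => ?_
    simp [Set.indicator_apply]

/-- An affine image of an arc of an irrational rotation is uniformly distributed. -/
theorem Irrational.hasFrequency_affine {α : ℝ} (hα : Irrational α) {b w e σ s t : ℝ} (hw0 : 0 < w)
    (hw1 : w ≤ 1) (hσ : σ ≠ 0) (hst : s < t) :
    HasFrequency {n : ℕ | Int.fract (n * α - b) < w ∧ s ≤ e + σ * Int.fract (n * α - b) ∧
      e + σ * Int.fract (n * α - b) < t}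
      (w * ∫ y in s..t, uniformDensity (min e (e + σ * w)) (max e (e + σ * w)) y) := by
  rcases lt_or_gt_of_ne hσ with hσ | hσ
  · have hneg : σ * w < 0 := mul_neg_of_neg_of_pos hσ hw0
    rw [min_eq_right (by linarith), max_eq_left (by linarith),
      intervalIntegral_uniformDensity (by linarith) hst.le]
    -- `S` and `T` are `s` and `t` clamped to the image of the arc. As `σ < 0`, the preimage runs
    -- from `(T - e) / σ` up to `(S - e) / σ`.
    set T := max (e + σ * w) (min e t) with hT
    set S := max (e + σ * w) (min e s) with hS
    have hval : w * ((T - S) / (e - (e + σ * w))) = (S - e) / σ - (T - e) / σ := by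
      field_simp
      ring
    have hST : S ≤ T := max_le_max le_rfl (min_le_min le_rfl hst.le)
    have hTe : T ≤ e := max_le (by linarith) (min_le_left _ _)
    have hSw : e + σ * w ≤ S := le_max_left _ _
    rw [hval]
    refine hα.hasFrequency_of_interval (b := b) (div_nonneg_of_nonpos (by linarith) hσ.le) ?_ ?_ ?_ ?_
    · exact div_le_div_of_nonpos_of_le hσ.le (by linarith)
    · refine le_trans ?_ hw1
      rw [div_le_iff_of_neg hσ]; linarith
    · intro n h1 h2
      rw [div_lt_iff_of_neg hσ] at h1
      rw [lt_div_iff_of_neg hσ] at h2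
      have h0 := Int.fract_nonneg (n * α - b)
      simp only [Set.mem_ofPred_eq]
      generalize Int.fract (n * α - b) = u at *
      have h3 : σ * u ≤ 0 := mul_nonpos_of_nonpos_of_nonneg hσ.le h0
      have h4 : σ * w < σ * u := by linarith
      refine ⟨(mul_lt_mul_left_of_neg hσ).1 h4, ?_, ?_⟩ <;> grind
    · rintro n ⟨h1, h2, h3⟩
      rw [div_le_iff_of_neg hσ, le_div_iff_of_neg hσ]
      have h0 := Int.fract_nonneg (n * α - b)
      generalize Int.fract (n * α - b) = u at *
      have h3 : σ * u ≤ 0 := mul_nonpos_of_nonpos_of_nonneg hσ.le h0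
      have h4 : σ * w < σ * u := (mul_lt_mul_left_of_neg hσ).2 h1
      constructor <;> grind
  · have hpos : 0 < σ * w := mul_pos hσ hw0
    rw [min_eq_left (by linarith), max_eq_right (by linarith),
      intervalIntegral_uniformDensity (by linarith) hst.le]
    set T := max e (min (e + σ * w) t) with hT
    set S := max e (min (e + σ * w) s) with hS
    have hval : w * ((T - S) / (e + σ * w - e)) = (T - e) / σ - (S - e) / σ := by
      field_simp
      ring
    have hST : S ≤ T := max_le_max le_rfl (min_le_min le_rfl hst.le)
    have hSe : e ≤ S := le_max_left _ _
    have hTw : T ≤ e + σ * w := max_le (by linarith) (min_le_left _ _)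
    rw [hval]
    refine hα.hasFrequency_of_interval (b := b) (div_nonneg (by linarith) hσ.le) ?_ ?_ ?_ ?_
    · gcongr
    · refine le_trans ?_ hw1
      rw [div_le_iff₀ hσ]; linarith
    · intro n h1 h2
      rw [div_lt_iff₀ hσ] at h1
      rw [lt_div_iff₀ hσ] at h2
      have h0 := Int.fract_nonneg (n * α - b)
      simp only [Set.mem_ofPred_eq]
      generalize Int.fract (n * α - b) = u at *
      have h3 : 0 ≤ σ * u := mul_nonneg hσ.le h0
      have h4 : σ * u < σ * w := by linarith
      refine ⟨(mul_lt_mul_iff_right₀ hσ).1 h4, ?_, ?_⟩ <;> grind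
    · rintro n ⟨h1, h2, h3⟩
      rw [div_le_iff₀ hσ, le_div_iff₀ hσ]
      have h0 := Int.fract_nonneg (n * α - b)
      generalize Int.fract (n * α - b) = u at *
      have h3 : 0 ≤ σ * u := mul_nonneg hσ.le h0
      have h4 : σ * u < σ * w := (mul_lt_mul_iff_right₀ hσ).2 h1
      constructor <;> grind

/-! ### Sums of sawtooth functions -/

section Arcs

variable {ι : Type*} [Fintype ι]

/-- The distance, going up modulo one, from the point `b i` to the next of the points `b j`. -/
noncomputable def arcLength (b : ι → ℝ) (i : ι) : ℝ :=
  Finset.univ.inf' (Finset.univ_nonempty_iff.2 ⟨i⟩) fun j => 1 - Int.fract (b i - b j)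

theorem lt_arcLength_iff {b : ι → ℝ} {i : ι} {u : ℝ} :
    u < arcLength b i ↔ ∀ j, u < 1 - Int.fract (b i - b j) := by
  rw [arcLength, Finset.lt_inf'_iff]
  simp

theorem arcLength_pos (b : ι → ℝ) (i : ι) : 0 < arcLength b i :=
  lt_arcLength_iff.2 fun _ => sub_pos.2 (Int.fract_lt_one _)

theorem arcLength_le (b : ι → ℝ) (i j : ι) : arcLength b i ≤ 1 - Int.fract (b i - b j) :=
  Finset.inf'_le _ (Finset.mem_univ j)

theorem arcLength_le_one (b : ι → ℝ) (i : ι) : arcLength b i ≤ 1 := by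
  simpa using arcLength_le b i i

theorem exists_arcLength_eq (b : ι → ℝ) (i : ι) :
    ∃ j, arcLength b i = 1 - Int.fract (b i - b j) := by
  obtain ⟨j, -, hj⟩ := Finset.exists_mem_eq_inf' (Finset.univ_nonempty_iff.2 ⟨i⟩)
    fun j => 1 - Int.fract (b i - b j)
  exact ⟨j, hj⟩

/-- Going up from `b i` to `x` meets no further `b j`, so the two fractional parts add without a
carry. -/
theorem fract_sub_of_lt_arcLength {b : ι → ℝ} {i : ι} {x : ℝ}
    (h : Int.fract (x - b i) < arcLength b i) (j : ι) :
    Int.fract (x - b j) = Int.fract (b i - b j) + Int.fract (x - b i) := by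
  have h1 := lt_arcLength_iff.1 h j
  refine Int.fract_eq_of_sub_eq (add_nonneg (Int.fract_nonneg _) (Int.fract_nonneg _))
    (by linarith) (⌊b i - b j⌋ + ⌊x - b i⌋) ?_
  push_cast
  linarith [Int.self_sub_fract (b i - b j), Int.self_sub_fract (x - b i)]

/-- Take the `b i` closest below `x`: a carry against some `b j` would make `b j` strictly closer.
-/
theorem exists_fract_sub_lt_arcLength [Nonempty ι] (b : ι → ℝ) (x : ℝ) :
    ∃ i, Int.fract (x - b i) < arcLength b i := by
  obtain ⟨i, hi⟩ := Finite.exists_min fun i => Int.fract (x - b i)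
  refine ⟨i, lt_arcLength_iff.2 fun j => ?_⟩
  by_contra! hc
  have h1 := Int.fract_lt_one (b i - b j)
  have h2 := Int.fract_lt_one (x - b i)
  have := Int.fract_eq_of_sub_eq (x := x - b j)
    (y := Int.fract (b i - b j) + Int.fract (x - b i) - 1) (by linarith) (by linarith)
    (⌊b i - b j⌋ + ⌊x - b i⌋ + 1)
    (by push_cast; linarith [Int.self_sub_fract (b i - b j), Int.self_sub_fract (x - b i)])
  linarith [hi j]

theorem Irrational.fract_ne_zero {x : ℝ} (h : Irrational x) : Int.fract x ≠ 0 := fun h0 =>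
  h.ne_int ⌊x⌋ (by linarith [Int.self_sub_fract x])

/-- A point common to two arcs gives `{b i - b j} + {b j - b i} = 0`, which distinct points mod 1
forbid. -/
theorem disjoint_arcs {α : ℝ} {b : ι → ℝ} (hb : ∀ i j, i ≠ j → Irrational (b i - b j)) :
    Pairwise fun i j => Disjoint {n : ℕ | Int.fract (n * α - b i) < arcLength b i}
      {n : ℕ | Int.fract (n * α - b j) < arcLength b j} := by
  refine fun i j hij => Set.disjoint_left.2 fun n hi hj => ?_
  have h1 := fract_sub_of_lt_arcLength (x := n * α) hi j
  have h2 := fract_sub_of_lt_arcLength (x := n * α) hj i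
  refine (hb i j hij).fract_ne_zero ?_
  linarith [Int.fract_nonneg (b i - b j), Int.fract_nonneg (b j - b i)]

theorem Irrational.hasFrequency_arc {α : ℝ} (hα : Irrational α) (b : ι → ℝ) (i : ι) :
    HasFrequency {n : ℕ | Int.fract (n * α - b i) < arcLength b i} (arcLength b i) :=
  hα.hasFrequency_initial (b := b i) (arcLength_pos b i).le (arcLength_le_one b i) (fun _ h => h)
    fun _ h => le_of_lt h

theorem sum_arcLength [Nonempty ι] {b : ι → ℝ} (hb : ∀ i j, i ≠ j → Irrational (b i - b j)) :
    ∑ i, arcLength b i = 1 := by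
  -- The arcs partition the circle; an auxiliary irrational rotation measures them by frequencies.
  -- Any irrational would do.
  have hα := irrational_sqrt_two
  refine (HasFrequency.iUnion (disjoint_arcs hb) (hα.hasFrequency_arc b)).unique ?_
  convert hasFrequency_univ
  exact Set.eq_univ_of_forall fun n => Set.mem_iUnion.2 (exists_fract_sub_lt_arcLength b _)

theorem sum_fract_of_lt_arcLength {b : ι → ℝ} {i : ι} {x : ℝ}
    (h : Int.fract (x - b i) < arcLength b i) :
    ∑ j, Int.fract (x - b j) =
      ∑ j, Int.fract (b i - b j) + Fintype.card ι * Int.fract (x - b i) := by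
  rw [Finset.sum_congr rfl fun j _ => fract_sub_of_lt_arcLength h j]
  simp [Finset.sum_add_distrib]

end Arcs

/-- On the `i`-th arc the value is affine in `{nα - b i}` with slope `σ r`, hence uniform there with
weight `arcLength b i`. The `min` and `max` allow either sign of `σ`; the endpoints are explicit so
that the one-point case can be evaluated. -/
theorem Irrational.hasLimitDensity_sawtooth {α : ℝ} (hα : Irrational α) {r : ℕ} (hr : r ≠ 0)
    {b : Fin r → ℝ} (hb : ∀ i j, i ≠ j → Irrational (b i - b j)) {σ : ℝ} (hσ : σ ≠ 0) (c : ℝ)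
    {x : ℕ → ℝ} (hx : ∀ n : ℕ, x n = c + σ * ∑ j, Int.fract (n * α - b j)) :
    ∃ p q : Fin r → ℝ, (∀ i, p i = min (c + σ * ∑ j, Int.fract (b i - b j))
        (c + σ * ∑ j, Int.fract (b i - b j) + σ * r * arcLength b i)) ∧
      (∀ i, q i = max (c + σ * ∑ j, Int.fract (b i - b j))
        (c + σ * ∑ j, Int.fract (b i - b j) + σ * r * arcLength b i)) ∧ (∀ i, p i < q i) ∧
      HasLimitDensity x (fun y => ∑ i, arcLength b i * uniformDensity (p i) (q i) y) := by
  have : Nonempty (Fin r) := Fin.pos_iff_nonempty.1 (Nat.pos_of_ne_zero hr)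
  have hσr : σ * r ≠ 0 := mul_ne_zero hσ (by exact_mod_cast hr)
  have hpq : ∀ i, min (c + σ * ∑ j, Int.fract (b i - b j))
        (c + σ * ∑ j, Int.fract (b i - b j) + σ * r * arcLength b i) <
      max (c + σ * ∑ j, Int.fract (b i - b j))
        (c + σ * ∑ j, Int.fract (b i - b j) + σ * r * arcLength b i) := fun i => by
    rw [min_lt_max]
    have := mul_ne_zero hσr (arcLength_pos b i).ne'
    intro h
    exact this (by linarith)
  refine ⟨_, _, fun _ => rfl, fun _ => rfl, hpq, IsUniformMixture.hasLimitDensity (arcLength_pos b)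
    (sum_arcLength hb) hpq fun s t hst => ?_⟩
  have key := HasFrequency.iUnion (A := fun i => {n : ℕ | Int.fract (n * α - b i) < arcLength b i ∧
      s ≤ c + σ * ∑ j, Int.fract (b i - b j) + σ * r * Int.fract (n * α - b i) ∧
      c + σ * ∑ j, Int.fract (b i - b j) + σ * r * Int.fract (n * α - b i) < t})
    (fun i j hij => (disjoint_arcs (α := α) hb hij).mono (fun _ h => h.1) (fun _ h => h.1))
    fun i => hα.hasFrequency_affine (arcLength_pos b i) (arcLength_le_one b i) hσr hst
  convert key
  ext n
  have hval : ∀ i, Int.fract (n * α - b i) < arcLength b i →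
      x n = c + σ * ∑ j, Int.fract (b i - b j) + σ * r * Int.fract (n * α - b i) := fun i hi => by
    rw [hx, sum_fract_of_lt_arcLength hi, Fintype.card_fin]
    ring
  simp only [Set.mem_iUnion, Set.mem_ofPred_eq]
  constructor
  · intro h
    obtain ⟨i, hi⟩ := exists_fract_sub_lt_arcLength b (n * α)
    exact ⟨i, hi, by rwa [← hval i hi]⟩
  · rintro ⟨i, hi, h⟩
    rwa [hval i hi]

/-! ### Intervals of bounded discrepancy -/

/-- The discrepancy of `x, x + α, …, x + (N - 1) α` for the interval `[0, L)` mod `1`. -/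
noncomputable def rotationSum (α L : ℝ) (N : ℕ) (x : ℝ) : ℝ :=
  ∑ n ∈ Finset.range N, ((if Int.fract (x + n * α) < L then (1 : ℝ) else 0) - L)

theorem rotationSum_succ (α L : ℝ) (N : ℕ) (x : ℝ) :
    rotationSum α L (N + 1) x =
      ((if Int.fract x < L then (1 : ℝ) else 0) - L) + rotationSum α L N (x + α) := by
  rw [rotationSum, Finset.sum_range_succ', add_comm, rotationSum]
  congr 1
  · simp
  · refine Finset.sum_congr rfl fun n _ => ?_
    rw [show x + ((n + 1 : ℕ) : ℝ) * α = x + α + n * α by push_cast; ring]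

theorem rotationSum_add (α L : ℝ) (M N : ℕ) (x : ℝ) :
    rotationSum α L (M + N) x = rotationSum α L M x + rotationSum α L N (x + M * α) := by
  rw [rotationSum, Finset.sum_range_add, rotationSum, rotationSum]
  congr 1
  refine Finset.sum_congr rfl fun n _ => ?_
  rw [show x + ((M + n : ℕ) : ℝ) * α = x + M * α + n * α by push_cast; ring]

theorem rotationSum_add_intCast (α L : ℝ) (N : ℕ) (x : ℝ) (z : ℤ) :
    rotationSum α L N (x + z) = rotationSum α L N x := by
  refine Finset.sum_congr rfl fun n _ => ?_
  rw [show x + z + n * α = x + n * α + z by ring, Int.fract_add_intCast]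

theorem rotationSum_fract (α L : ℝ) (N : ℕ) (x : ℝ) :
    rotationSum α L N (Int.fract x) = rotationSum α L N x := by
  rw [← rotationSum_add_intCast α L N (Int.fract x) ⌊x⌋, Int.fract_add_floor]

theorem rotationDiscrepancy_eq_rotationSum (α b L : ℝ) (N : ℕ) :
    rotationDiscrepancy α b L N = rotationSum α L N (α - b) := by
  rw [rotationDiscrepancy, ← Finset.Ico_succ_right_eq_Icc, Finset.sum_Ico_eq_sum_range, rotationSum]
  refine Finset.sum_congr (by simp) fun n _ => ?_
  rw [show ((1 + n : ℕ) : ℝ) * α - b = α - b + n * α by push_cast; ring]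

theorem measurable_rotationSum (α L : ℝ) (N : ℕ) : Measurable (rotationSum α L N) := by
  unfold rotationSum
  refine Finset.measurable_fun_sum _ fun n _ => Measurable.sub ?_ measurable_const
  refine Measurable.ite (measurableSet_lt ?_ measurable_const) measurable_const measurable_const
  exact measurable_fract.comp (measurable_id.add_const _)

/-- The indicator of a half-open arc is right-continuous. -/
theorem eventually_fract_add_lt_iff {L : ℝ} (hL1 : L ≤ 1) (y : ℝ) :
    ∀ᶠ δ in 𝓝[>] (0 : ℝ), (Int.fract (y + δ) < L ↔ Int.fract y < L) := by
  have h0 := Int.fract_nonneg y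
  have h1 := Int.fract_lt_one y
  have hsmall : ∀ ε > (0 : ℝ), ∀ᶠ δ in 𝓝[>] (0 : ℝ), 0 < δ ∧ δ < ε := fun ε hε =>
    Ioo_mem_nhdsGT hε
  have hadd : ∀ δ : ℝ, 0 < δ → δ < 1 - Int.fract y → Int.fract (y + δ) = Int.fract y + δ :=
    fun δ hδ0 hδ1 => Int.fract_eq_of_sub_eq (by linarith) (by linarith) ⌊y⌋
      (by linarith [Int.self_sub_fract y])
  by_cases h : Int.fract y < L
  · filter_upwards [hsmall (L - Int.fract y) (by linarith)] with δ hδ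
    rw [hadd δ hδ.1 (by linarith)]
    exact ⟨fun _ => h, fun _ => by linarith⟩
  · filter_upwards [hsmall (1 - Int.fract y) (by linarith)] with δ hδ
    rw [hadd δ hδ.1 (by linarith)]
    exact ⟨fun _ => by linarith, fun h' => absurd h' h⟩

theorem eventually_rotationSum_add_eq {L : ℝ} (hL1 : L ≤ 1) (α : ℝ) (N : ℕ) (x : ℝ) :
    ∀ᶠ δ in 𝓝[>] (0 : ℝ), rotationSum α L N (x + δ) = rotationSum α L N x := by
  have : ∀ᶠ δ in 𝓝[>] (0 : ℝ), ∀ n ∈ Finset.range N,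
      (Int.fract (x + n * α + δ) < L ↔ Int.fract (x + n * α) < L) :=
    (eventually_all_finset _).2 fun n _ => eventually_fract_add_lt_iff hL1 _
  filter_upwards [this] with δ hδ
  refine Finset.sum_congr rfl fun n hn => ?_
  simp only [show x + δ + n * α = x + n * α + δ by ring, hδ n hn]

/-- The orbit of `x₀` approaches `x` from above mod 1, so by right-continuity the sum at `x` equals
the sum at some `x₀ + mα`, a difference of two sums started at `x₀`; hence the factor 2. -/
theorem Irrational.abs_rotationSum_le {α : ℝ} (hα : Irrational α) {L C x₀ : ℝ} (hL1 : L ≤ 1)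
    (hC : ∀ N, |rotationSum α L N x₀| ≤ C) (N : ℕ) (x : ℝ) :
    |rotationSum α L N x| ≤ 2 * C := by
  obtain ⟨ε, hε, hsub⟩ := mem_nhdsGT_iff_exists_Ioo_subset.1 (eventually_rotationSum_add_eq hL1 α N x)
  obtain ⟨m, hm0, hm1⟩ := hα.exists_fract_mem_Ioo (x - x₀) le_rfl
    (lt_min hε zero_lt_one) (min_le_right ε 1)
  have h1 : rotationSum α L N (x₀ + m * α) = rotationSum α L N x := by
    have h2 : rotationSum α L N (x + Int.fract (m * α - (x - x₀))) = rotationSum α L N x :=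
      hsub ⟨hm0, hm1.trans_le (min_le_left _ _)⟩
    rw [← h2, ← rotationSum_add_intCast α L N (x + _) ⌊m * α - (x - x₀)⌋]
    congr 1
    linarith [Int.self_sub_fract (m * α - (x - x₀))]
  have h3 := rotationSum_add α L m N x₀
  rw [h1] at h3
  have h4 := abs_le.1 (hC m)
  have h5 := abs_le.1 (hC (m + N))
  exact abs_le.2 ⟨by linarith, by linarith⟩

/-- A bounded solution of the cohomological equation of the rotation for the interval `[0, L)`. -/
noncomputable def rotationCoboundary (α L x : ℝ) : ℝ :=
  limsup (fun N => rotationSum α L N x) atTop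

theorem measurable_rotationCoboundary (α L : ℝ) : Measurable (rotationCoboundary α L) :=
  Measurable.limsup (measurable_rotationSum α L)

theorem rotationCoboundary_fract (α L x : ℝ) :
    rotationCoboundary α L (Int.fract x) = rotationCoboundary α L x := by
  simp only [rotationCoboundary, rotationSum_fract]

/-- Dropping one index does not change a limsup. The uniform bound is what lets the constant be
pulled out of a real-valued limsup. -/
theorem rotationCoboundary_eq {α L C : ℝ} (hC : ∀ N x, |rotationSum α L N x| ≤ C) (x : ℝ) :
    rotationCoboundary α L x =
      ((if Int.fract x < L then (1 : ℝ) else 0) - L) + rotationCoboundary α L (x + α) := by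
  unfold rotationCoboundary
  rw [← limsup_nat_add _ 1]
  simp only [rotationSum_succ]
  refine limsup_const_add _ _ _ ?_ ?_
  · exact isBoundedUnder_of ⟨C, fun N => (abs_le.1 (hC N _)).2⟩
  · exact (isBoundedUnder_of ⟨-C, fun N => (abs_le.1 (hC N _)).1⟩ :
      IsBoundedUnder (· ≥ ·) _ _).isCoboundedUnder_le

open AddCircle in
/-- The eigenvalues of the rotation by `α` are the numbers `exp (2 π i k α)`. -/
theorem exists_intCast_mul_eq_of_eigenfunction {α L : ℝ} {H : UnitAddCircle → ℂ}
    (hH : Measurable H) (hH1 : ∀ x, ‖H x‖ = 1)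
    (hrot : ∀ x, H (x + (α : UnitAddCircle)) = Complex.exp (2 * Real.pi * Complex.I * L) * H x) :
    ∃ k m : ℤ, k * α = L + m := by
  by_contra! hne
  -- Translation invariance multiplies the `n`-th coefficient by `exp(2πi(L - nα))`; a nonzero
  -- coefficient would make this factor 1. Parseval then contradicts `‖H‖ = 1`.
  have hzero : ∀ n : ℤ, fourierCoeff H n = 0 := fun n => by
    have h1 : fourierCoeff H n = fourier (-n) (α : UnitAddCircle) *
        Complex.exp (2 * Real.pi * Complex.I * L) * fourierCoeff H n := by
      conv_lhs => rw [fourierCoeff, ← integral_add_right_eq_self _ (α : UnitAddCircle)]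
      rw [fourierCoeff, ← integral_const_mul]
      refine integral_congr_ae (.of_forall fun t => ?_)
      have hadd : fourier (-n) (t + (α : UnitAddCircle)) =
          (fourier (-n) t : ℂ) * fourier (-n) (α : UnitAddCircle) := by
        simp only [fourier_apply, smul_add, toCircle_add, Circle.coe_mul]
      simp only [hrot, hadd, smul_eq_mul]
      ring
    by_contra h0
    have h2 : fourier (-n) (α : UnitAddCircle) * Complex.exp (2 * Real.pi * Complex.I * L) = 1 := by
      refine mul_right_cancel₀ h0 ?_
      rw [one_mul]
      exact h1.symm
    rw [fourier_coe_apply, ← Complex.exp_add, Complex.exp_eq_one_iff] at h2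
    obtain ⟨z, hz⟩ := h2
    refine hne n (-z) ?_
    have hpi := Complex.two_pi_I_ne_zero
    have h3 : (2 * Real.pi * Complex.I) * ((n * α : ℝ) : ℂ) =
        (2 * Real.pi * Complex.I) * ((L + (-z : ℤ) : ℝ) : ℂ) := by
      push_cast at hz ⊢
      linear_combination -hz
    exact_mod_cast mul_left_cancel₀ hpi h3
  have hLp : MemLp H 2 (haarAddCircle (T := 1)) :=
    MemLp.of_bound hH.aestronglyMeasurable 1 (.of_forall fun x => (hH1 x).le)
  have hpars := tsum_sq_fourierCoeff (hLp.toLp H)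
  have h1 : ∀ n : ℤ, fourierCoeff (hLp.toLp H) n = 0 := fun n => by
    rw [fourierCoeff_congr_ae hLp.coeFn_toLp, hzero]
  have h2 : ∫ t, ‖hLp.toLp H t‖ ^ 2 ∂(haarAddCircle (T := 1)) = 1 := by
    rw [integral_congr_ae (g := fun _ => (1 : ℝ))]
    · simp
    · filter_upwards [hLp.coeFn_toLp] with t ht
      simp [ht, hH1]
  rw [h2] at hpars
  simp [h1] at hpars

/-- **Kesten's theorem**: an interval of bounded discrepancy for the rotation by an irrational `α`
has length in `ℤ α + ℤ`. -/
theorem Irrational.exists_intCast_mul_eq_of_abs_rotationDiscrepancy_le {α : ℝ} (hα : Irrational α)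
    {b L C : ℝ} (hL1 : L ≤ 1) (hC : ∀ N, |rotationDiscrepancy α b L N| ≤ C) :
    ∃ k m : ℤ, k * α = L + m := by
  simp only [rotationDiscrepancy_eq_rotationSum] at hC
  have hg := rotationCoboundary_eq (fun N x => hα.abs_rotationSum_le hL1 hC N x)
  -- The indicator in the coboundary equation is integer-valued, so exponentiating removes it and
  -- leaves the factor `exp(2πiL)`.
  refine exists_intCast_mul_eq_of_eigenfunction (α := α) (L := L)
    (H := fun x => Complex.exp (2 * Real.pi * Complex.I *
      (rotationCoboundary α L (AddCircle.measurableEquivIco 1 0 x : ℝ) : ℝ))) ?_ ?_ ?_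
  · refine Complex.measurable_exp.comp (Measurable.const_mul ?_ _)
    refine Complex.measurable_ofReal.comp ((measurable_rotationCoboundary α L).comp ?_)
    exact measurable_subtype_coe.comp (AddCircle.measurableEquivIco 1 0).measurable
  · intro x
    rw [show ∀ y : ℝ, 2 * (Real.pi : ℂ) * Complex.I * (y : ℂ) = (2 * Real.pi * y : ℝ) * Complex.I from
      fun y => by push_cast; ring, Complex.norm_exp_ofReal_mul_I]
  · intro x
    obtain ⟨x, rfl⟩ := QuotientAddGroup.mk_surjective x
    have hu : ∀ y : ℝ, rotationCoboundary α L
        (AddCircle.measurableEquivIco 1 0 (y : UnitAddCircle) : ℝ) = rotationCoboundary α L y :=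
      fun y => by
        rw [← rotationCoboundary_fract α L y]
        congr 1
        have := AddCircle.coe_equivIco_mk_apply (1 : ℝ) y
        rw [div_one, mul_one] at this
        exact this
    have h1 := hu x
    have h2 := hu (x + α)
    rw [AddCircle.coe_add] at h2
    erw [h1, h2]
    rw [← Complex.exp_add, Complex.exp_eq_exp_iff_exists_int]
    have h3 := hg x
    split_ifs at h3
    · refine ⟨-1, ?_⟩
      rw [h3]; push_cast; ring
    · refine ⟨0, ?_⟩
      rw [h3]; push_cast; ring

/-! ### Benford errors of powers -/

theorem logb_one_add_lt_one {d : ℕ} (hd1 : 1 ≤ d) : Real.logb 10 (1 + 1 / (d : ℝ)) < 1 := by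
  have hd : (1 : ℝ) ≤ d := by exact_mod_cast hd1
  rw [Real.logb_lt_iff_lt_rpow (by norm_num) (by positivity), Real.rpow_one]
  have : 1 / (d : ℝ) ≤ 1 := by rw [div_le_one (by positivity)]; exact hd
  linarith

theorem zpow_eq_mul_ten_zpow_iff {a : ℝ} (ha : 0 < a) {d : ℕ} (hd1 : 1 ≤ d) (k m : ℤ) :
    a ^ k = ((d : ℝ) + 1) / (d : ℝ) * (10 : ℝ) ^ m ↔
      k * Real.logb 10 a = Real.logb 10 (1 + 1 / (d : ℝ)) + m := by
  have hd : (0 : ℝ) < d := by exact_mod_cast hd1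
  have h1 : (0 : ℝ) < ((d : ℝ) + 1) / d := by positivity
  have h2 : (0 : ℝ) < (10 : ℝ) ^ m := by positivity
  have h3 : 1 + 1 / (d : ℝ) = ((d : ℝ) + 1) / d := by field_simp
  rw [h3, ← logb_ten_zpow, ← logb_ten_ten_zpow m, ← Real.logb_mul h1.ne' h2.ne']
  exact ⟨fun h => by rw [h], fun h =>
    Real.logb_injOn_pos (by norm_num) (Set.mem_Ioi.2 (zpow_pos ha k)) (Set.mem_Ioi.2 (by positivity)) h⟩

/-- Otherwise `L` would be an integer, but `0 < L < 1`. -/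
theorem ne_zero_of_mul_eq_logb_one_add {α : ℝ} {d : ℕ} (hd1 : 1 ≤ d) {k m : ℤ}
    (h : k * α = Real.logb 10 (1 + 1 / (d : ℝ)) + m) : k ≠ 0 := by
  rintro rfl
  have h1 := logb_one_add_pos hd1
  have h2 := logb_one_add_lt_one hd1
  simp only [Int.cast_zero, zero_mul] at h
  have h3 : ((-1 : ℤ) : ℝ) < m := by push_cast; linarith
  have h4 : (m : ℝ) < (0 : ℤ) := by push_cast; linarith
  have h5 := Int.cast_lt.1 h3
  have h6 := Int.cast_lt.1 h4
  lia

theorem hasBoundedBenfordError_iff {a : ℝ} (ha : 0 < a) (hirr : Irrational (Real.logb 10 a))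
    {d : ℕ} (hd1 : 1 ≤ d) (hd9 : d ≤ 9) :
    HasBoundedBenfordError d (fun n => a ^ n) ↔
      ∃ k m : ℤ, k * Real.logb 10 a = Real.logb 10 (1 + 1 / (d : ℝ)) + m := by
  have hE := benfordError_pow ha hd1 hd9
  unfold benfordError at hE
  unfold HasBoundedBenfordError
  simp only [hE]
  constructor
  · rintro ⟨C, hC⟩
    refine hirr.exists_intCast_mul_eq_of_abs_rotationDiscrepancy_le (b := Real.logb 10 d) (C := C)
      (logb_one_add_le_one hd1 hd9) fun N => ?_
    rcases N.eq_zero_or_pos with rfl | hN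
    · have := (abs_nonneg _).trans (hC 1 le_rfl)
      simpa [rotationDiscrepancy] using this
    · exact hC N hN
  · rintro ⟨k, m, h⟩
    exact ⟨k.natAbs, fun N _ => abs_rotationDiscrepancy_le (logb_one_add_pos hd1).le
      (logb_one_add_le_one hd1 hd9) h N⟩

theorem Irrational.natCast_mul_sub_natCast_mul {α : ℝ} (hα : Irrational α) {i j : ℕ} (h : i ≠ j) :
    Irrational (i * α - j * α) := by
  rw [← sub_mul]
  have : (i : ℝ) * α - j * α = ((i - j : ℤ) : ℝ) * α := by push_cast; ring
  rw [← sub_mul] at this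
  rw [this]
  exact hα.intCast_mul (sub_ne_zero.2 (by exact_mod_cast h))

/-- An interval of length in `ℤ α + ℤ` has a discrepancy that is a sum of sawtooth functions. -/
theorem Irrational.exists_rotationDiscrepancy_eq_sawtooth {α : ℝ} (hα : Irrational α) {β L : ℝ}
    (hL0 : 0 ≤ L) (hL1 : L ≤ 1) {k m : ℤ} (h : k * α = L + m) :
    ∃ (b : Fin k.natAbs → ℝ) (σ c : ℝ), (∀ i j, i ≠ j → Irrational (b i - b j)) ∧ |σ| = 1 ∧
      ∀ N : ℕ, rotationDiscrepancy α β L N = c + σ * ∑ j, Int.fract (N * α - b j) := by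
  obtain ⟨r, rfl | rfl⟩ := k.eq_nat_or_neg
  · rw [Int.natAbs_natCast]
    refine ⟨fun j => β + j * α, -1, ∑ j ∈ Finset.range r, Int.fract (-j * α - β), ?_, by simp,
      fun N => ?_⟩
    · intro i j hij
      rw [add_sub_add_left_eq_sub]
      exact hα.natCast_mul_sub_natCast_mul (Fin.val_ne_of_ne hij)
    · rw [rotationDiscrepancy_of_pos hL0 hL1 (r := r) (m := m) (by exact_mod_cast h),
        Finset.sum_sub_distrib, Fin.sum_univ_eq_sum_range fun j => Int.fract (N * α - (β + j * α))]
      ring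
  · rw [Int.natAbs_neg, Int.natAbs_natCast]
    refine ⟨fun j => β - (j + 1) * α, 1, -∑ j ∈ Finset.range r, Int.fract ((j + 1) * α - β), ?_,
      by simp, fun N => ?_⟩
    · intro i j hij
      rw [show β - (i + 1) * α - (β - (j + 1) * α) = j * α - i * α by ring]
      exact hα.natCast_mul_sub_natCast_mul (Fin.val_ne_of_ne hij.symm)
    · rw [rotationDiscrepancy_of_neg hL0 hL1 (r := r) (m := m) (by exact_mod_cast h),
        Finset.sum_sub_distrib,
        Fin.sum_univ_eq_sum_range fun j => Int.fract (N * α - (β - (j + 1) * α))]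
      ring

theorem Irrational.exists_uniformMixture_hasLimitDensity {α : ℝ} (hα : Irrational α) {β L : ℝ}
    (hL0 : 0 ≤ L) (hL1 : L ≤ 1) {k m : ℤ} (hk : k ≠ 0) (h : k * α = L + m) :
    ∃ f : ℝ → ℝ, IsUniformMixture k.natAbs f ∧ HasLimitDensity (rotationDiscrepancy α β L) f := by
  have hr : k.natAbs ≠ 0 := Int.natAbs_ne_zero.2 hk
  have : Nonempty (Fin k.natAbs) := Fin.pos_iff_nonempty.1 (Nat.pos_of_ne_zero hr)
  obtain ⟨b, σ, c, hb, hσ, hE⟩ :=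
    hα.exists_rotationDiscrepancy_eq_sawtooth (β := β) hL0 hL1 h
  have hσ0 : σ ≠ 0 := by rintro rfl; simp at hσ
  obtain ⟨p, q, -, -, hpq, hlim⟩ := hα.hasLimitDensity_sawtooth hr hb hσ0 c hE
  exact ⟨_, ⟨arcLength b, p, q, arcLength_pos b, sum_arcLength hb, hpq, fun _ => rfl⟩, hlim⟩

/-- The lengths average `1/r`, so otherwise all equal `1/r`. But a length is `1 - {b i - b j}`,
which is irrational for `j ≠ i` and equals 1 for `j = i`. -/
theorem exists_one_lt_mul_arcLength {r : ℕ} (hr : 1 < r) {b : Fin r → ℝ}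
    (hb : ∀ i j, i ≠ j → Irrational (b i - b j)) : ∃ i, 1 < r * arcLength b i := by
  by_contra! hle
  have hr0 : (r : ℝ) ≠ 0 := by positivity
  let i : Fin r := ⟨0, by lia⟩
  have : Nonempty (Fin r) := ⟨i⟩
  have hsum : ∑ i, r * arcLength b i = ∑ _i : Fin r, (1 : ℝ) := by
    rw [← Finset.mul_sum, sum_arcLength hb]; simp
  have hi := (Finset.sum_eq_sum_iff_of_le fun i _ => hle i).1 hsum i (Finset.mem_univ i)
  obtain ⟨j, hj⟩ := exists_arcLength_eq b i
  rw [hj] at hi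
  by_cases hij : i = j
  · subst hij
    simp only [sub_self, Int.fract_zero, sub_zero, mul_one, Nat.cast_eq_one] at hi
    lia
  · refine hb i j hij ⟨⌊b i - b j⌋ + 1 - 1 / r, ?_⟩
    have h1 : Int.fract (b i - b j) = 1 - 1 / r := by field_simp; linarith
    push_cast
    linarith [Int.self_sub_fract (b i - b j)]

/-- A discrepancy whose oscillation is less than one is a single sawtooth function. -/
theorem Irrational.natAbs_eq_one {α : ℝ} (hα : Irrational α) {β L : ℝ}
    (hL0 : 0 ≤ L) (hL1 : L ≤ 1) {k m : ℤ} (hk : k ≠ 0) (h : k * α = L + m)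
    (hosc : ∀ M N, |rotationDiscrepancy α β L M - rotationDiscrepancy α β L N| < 1) :
    k.natAbs = 1 := by
  obtain ⟨b, σ, c, hb, hσ, hE⟩ :=
    hα.exists_rotationDiscrepancy_eq_sawtooth (β := β) hL0 hL1 h
  by_contra hk1
  have hr : 1 < k.natAbs := by lia
  obtain ⟨i, hi⟩ := exists_one_lt_mul_arcLength hr hb
  have hr0 : (0 : ℝ) < k.natAbs := by positivity
  set w := arcLength b i with hw
  -- Indices within `δ` of the two ends of this arc have fractional parts differing by more than `w
  -- - 2δ = 1/|k|`; the slope `|k|` turns this into an oscillation above 1.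
  set δ := (w - 1 / k.natAbs) / 2 with hδ
  have hwr : 1 / (k.natAbs : ℝ) < w := by rw [div_lt_iff₀ hr0]; linarith
  have hr1 : 0 < 1 / (k.natAbs : ℝ) := by positivity
  have hw1 : w ≤ 1 := arcLength_le_one b i
  obtain ⟨M, hM0, hM1⟩ := hα.exists_fract_mem_Ioo (b i) (p := w - δ) (q := w) (by linarith)
    (by linarith) hw1
  obtain ⟨N, hN0, hN1⟩ := hα.exists_fract_mem_Ioo (b i) (p := 0) (q := δ) le_rfl
    (by linarith) (by linarith)
  have := hosc M N
  rw [hE, hE, sum_fract_of_lt_arcLength (i := i) hM1,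
    sum_fract_of_lt_arcLength (i := i) (hN1.trans (by linarith)),
    add_sub_add_left_eq_sub, ← mul_sub, abs_mul, hσ, one_mul, add_sub_add_left_eq_sub, ← mul_sub,
    Fintype.card_fin] at this
  have h1 := (le_abs_self _).trans_lt this
  have h2 : k.natAbs * (1 / (k.natAbs : ℝ)) <
      k.natAbs * (Int.fract (M * α - b i) - Int.fract (N * α - b i)) := by
    refine mul_lt_mul_of_pos_left ?_ hr0
    linarith
  rw [mul_one_div_cancel hr0.ne'] at h2
  linarith

/-! ### Perfect hits -/

theorem isLowerPerfectHit_iff (d : ℕ) (u : ℕ → ℝ) :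
    IsLowerPerfectHit d u ↔ ∀ N, -1 < benfordError d u N ∧ benfordError d u N ≤ 0 := by
  have h0 : ∀ N : ℕ, (leadingDigitCount d u N : ℤ) = ⌊benfordPrediction d N⌋ ↔
      -1 < benfordError d u N ∧ benfordError d u N ≤ 0 := fun N => by
    rw [eq_comm, Int.floor_eq_iff, benfordError]
    push_cast
    constructor <;> rintro ⟨h1, h2⟩ <;> constructor <;> linarith
  simp only [IsLowerPerfectHit, h0]
  refine ⟨fun h N => ?_, fun h N _ => h N⟩
  rcases N.eq_zero_or_pos with rfl | hN
  · simp [benfordError, leadingDigitCount, benfordPrediction]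
  · exact h N hN

theorem isUpperPerfectHit_iff (d : ℕ) (u : ℕ → ℝ) :
    IsUpperPerfectHit d u ↔ ∀ N, 0 ≤ benfordError d u N ∧ benfordError d u N < 1 := by
  have h0 : ∀ N : ℕ, (leadingDigitCount d u N : ℤ) = ⌈benfordPrediction d N⌉ ↔
      0 ≤ benfordError d u N ∧ benfordError d u N < 1 := fun N => by
    rw [eq_comm, Int.ceil_eq_iff, benfordError]
    push_cast
    constructor <;> rintro ⟨h1, h2⟩ <;> constructor <;> linarith
  simp only [IsUpperPerfectHit, h0]
  refine ⟨fun h N => ?_, fun h N _ => h N⟩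
  rcases N.eq_zero_or_pos with rfl | hN
  · simp [benfordError, leadingDigitCount, benfordPrediction]
  · exact h N hN

theorem hasBoundedBenfordError_of_mem_Icc {d : ℕ} {u : ℕ → ℝ}
    (h : ∀ N, -1 ≤ benfordError d u N ∧ benfordError d u N ≤ 1) : HasBoundedBenfordError d u :=
  ⟨1, fun N _ => abs_le.2 (h N)⟩

theorem rotationDiscrepancy_of_one {α β L : ℝ} (hL0 : 0 ≤ L) (hL1 : L ≤ 1) {m : ℤ}
    (h : α = L + m) (N : ℕ) :
    rotationDiscrepancy α β L N = Int.fract (-β) - Int.fract (N * α - β) := by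
  rw [rotationDiscrepancy_of_pos hL0 hL1 (r := 1) (m := m) (by simpa using h)]
  simp

theorem rotationDiscrepancy_of_neg_one {α β L : ℝ} (hL0 : 0 ≤ L) (hL1 : L ≤ 1) {m : ℤ}
    (h : -α = L + m) (N : ℕ) :
    rotationDiscrepancy α β L N = Int.fract (N * α - (β - α)) - Int.fract (-(L + β)) := by
  rw [rotationDiscrepancy_of_neg hL0 hL1 (r := 1) (m := m) (by simpa using h)]
  simp only [Finset.range_one, Finset.sum_singleton, Nat.cast_zero, zero_add, one_mul]
  rw [← Int.fract_add_intCast (-(L + β)) (-m)]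
  congr 2
  push_cast
  linarith

theorem Irrational.fract_eq_zero_of_le {α : ℝ} (hα : Irrational α) {b y : ℝ}
    (h : ∀ N : ℕ, Int.fract y ≤ Int.fract (N * α - b)) : Int.fract y = 0 := by
  by_contra h0
  obtain ⟨N, -, hN⟩ := hα.exists_fract_mem_Ioo b le_rfl
    (lt_of_le_of_ne (Int.fract_nonneg y) (Ne.symm h0)) (Int.fract_lt_one y).le
  exact absurd (h N) (not_le.2 hN)

theorem Irrational.exists_fract_lt {α : ℝ} (hα : Irrational α) (b y : ℝ) :
    ∃ N : ℕ, Int.fract y < Int.fract (N * α - b) := by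
  obtain ⟨N, hN, -⟩ := hα.exists_fract_mem_Ioo b (Int.fract_nonneg y) (Int.fract_lt_one y) le_rfl
  exact ⟨N, hN⟩

theorem Irrational.eq_add_intCast_or_neg_eq_add_intCast {a : ℝ} (ha : 0 < a)
    (hirr : Irrational (Real.logb 10 a)) {d : ℕ} (hd1 : 1 ≤ d) (hd9 : d ≤ 9)
    (hbdd : HasBoundedBenfordError d fun n => a ^ n)
    (hosc : ∀ M N, |benfordError d (fun n => a ^ n) M - benfordError d (fun n => a ^ n) N| < 1) :
    ∃ m : ℤ, Real.logb 10 a = Real.logb 10 (1 + 1 / (d : ℝ)) + m ∨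
      -Real.logb 10 a = Real.logb 10 (1 + 1 / (d : ℝ)) + m := by
  obtain ⟨k, m, h⟩ := (hasBoundedBenfordError_iff ha hirr hd1 hd9).1 hbdd
  simp only [benfordError_pow ha hd1 hd9] at hosc
  have hk := hirr.natAbs_eq_one (logb_one_add_pos hd1).le (logb_one_add_le_one hd1 hd9)
    (ne_zero_of_mul_eq_logb_one_add hd1 h) h hosc
  refine ⟨m, ?_⟩
  rcases Int.natAbs_eq k with hk' | hk' <;> rw [hk', hk] at h
  · left; simpa using h
  · right; simpa using h

theorem eq_intCast_of_fract_eq_zero {x : ℝ} (h : Int.fract x = 0) : x = ⌊x⌋ := by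
  linarith [Int.self_sub_fract x]

theorem eq_one_of_fract_neg_logb_eq_zero {d : ℕ} (hd1 : 1 ≤ d) (hd9 : d ≤ 9)
    (h : Int.fract (-Real.logb 10 d) = 0) : d = 1 := by
  have h0 := logb_natCast_nonneg hd1
  have h1 : Real.logb 10 d < 1 := by
    linarith [logb_add_logb_one_add hd1, logb_one_add_pos hd1, logb_natCast_add_one_le_one hd9]
  have h2 := eq_intCast_of_fract_eq_zero h
  have h3 : ⌊-Real.logb 10 (d : ℝ)⌋ = 0 := by
    have h4 : ((-1 : ℤ) : ℝ) < ⌊-Real.logb 10 (d : ℝ)⌋ := by rw [← h2]; push_cast; linarith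
    have h5 : (⌊-Real.logb 10 (d : ℝ)⌋ : ℝ) ≤ (0 : ℤ) := by rw [← h2]; push_cast; linarith
    have h6 := Int.cast_lt.1 h4
    have h7 := Int.cast_le.1 h5
    lia
  have h4 : Real.logb 10 (d : ℝ) = Real.logb 10 1 := by
    rw [h3] at h2
    rw [Real.logb_one]
    push_cast at h2
    linarith
  have h5 := Real.logb_injOn_pos (by norm_num) (Set.mem_Ioi.2 (by exact_mod_cast hd1))
    (Set.mem_Ioi.2 one_pos) h4
  exact_mod_cast h5

theorem eq_nine_of_fract_neg_logb_eq_zero {d : ℕ} (hd1 : 1 ≤ d) (hd9 : d ≤ 9)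
    (h : Int.fract (-Real.logb 10 ((d : ℝ) + 1)) = 0) : d = 9 := by
  by_contra hd
  -- If `d ≠ 9`, then `d + 1` is again a digit and would have to be 1.
  have := eq_one_of_fract_neg_logb_eq_zero (d := d + 1) (by lia) (by lia) (by push_cast; exact h)
  lia

/-- For `k = 1` the error is `{-log₁₀ d}` minus a sawtooth coming arbitrarily close to 0, so
nonpositivity forces `{-log₁₀ d} = 0`. For `k = -1` the sawtooth enters positively and somewhere
exceeds the subtracted constant. -/
theorem isLowerPerfectHit_pow {a : ℝ} (ha : 0 < a) (hirr : Irrational (Real.logb 10 a))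
    {d : ℕ} (hd1 : 1 ≤ d) (hd9 : d ≤ 9) (h : IsLowerPerfectHit d fun n => a ^ n) :
    d = 1 ∧ ∃ m : ℤ, a = 2 * (10 : ℝ) ^ m := by
  have hL0 := (logb_one_add_pos hd1).le
  have hL1 := logb_one_add_le_one hd1 hd9
  rw [isLowerPerfectHit_iff] at h
  obtain ⟨m, hm⟩ := hirr.eq_add_intCast_or_neg_eq_add_intCast ha hd1 hd9
    (hasBoundedBenfordError_of_mem_Icc fun N => ⟨(h N).1.le, (h N).2.trans zero_le_one⟩)
    fun M N => abs_lt.2 ⟨by linarith [h M, h N], by linarith [h M, h N]⟩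
  simp only [benfordError_pow ha hd1 hd9] at h
  rcases hm with hm | hm
  · simp only [rotationDiscrepancy_of_one hL0 hL1 hm] at h
    have hd := eq_one_of_fract_neg_logb_eq_zero hd1 hd9
      (hirr.fract_eq_zero_of_le (b := Real.logb 10 d) fun N => by linarith [h N])
    refine ⟨hd, m, ?_⟩
    have := (zpow_eq_mul_ten_zpow_iff ha hd1 1 m).2 (by simpa using hm)
    rw [zpow_one, hd] at this
    rw [this]; norm_num
  · simp only [rotationDiscrepancy_of_neg_one hL0 hL1 hm] at h
    obtain ⟨N, hN⟩ := hirr.exists_fract_lt (Real.logb 10 d - Real.logb 10 a)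
      (-(Real.logb 10 (1 + 1 / (d : ℝ)) + Real.logb 10 d))
    linarith [h N]

/-- The signs are reversed: `k = 1` fails, and `k = -1` forces the constant `{-log₁₀ (d + 1)}` to
vanish. -/
theorem isUpperPerfectHit_pow {a : ℝ} (ha : 0 < a) (hirr : Irrational (Real.logb 10 a))
    {d : ℕ} (hd1 : 1 ≤ d) (hd9 : d ≤ 9) (h : IsUpperPerfectHit d fun n => a ^ n) :
    d = 9 ∧ ∃ m : ℤ, a = 9 * (10 : ℝ) ^ m := by
  have hL0 := (logb_one_add_pos hd1).le
  have hL1 := logb_one_add_le_one hd1 hd9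
  rw [isUpperPerfectHit_iff] at h
  obtain ⟨m, hm⟩ := hirr.eq_add_intCast_or_neg_eq_add_intCast ha hd1 hd9
    (hasBoundedBenfordError_of_mem_Icc fun N => ⟨by linarith [h N], (h N).2.le⟩)
    fun M N => abs_lt.2 ⟨by linarith [h M, h N], by linarith [h M, h N]⟩
  simp only [benfordError_pow ha hd1 hd9] at h
  rcases hm with hm | hm
  · simp only [rotationDiscrepancy_of_one hL0 hL1 hm] at h
    obtain ⟨N, hN⟩ := hirr.exists_fract_lt (Real.logb 10 d) (-Real.logb 10 d)
    linarith [h N]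
  · simp only [rotationDiscrepancy_of_neg_one hL0 hL1 hm] at h
    have h0 := hirr.fract_eq_zero_of_le (b := Real.logb 10 d - Real.logb 10 a)
      (y := -(Real.logb 10 (1 + 1 / (d : ℝ)) + Real.logb 10 d)) fun N => by linarith [h N]
    rw [add_comm, logb_add_logb_one_add hd1] at h0
    have hd := eq_nine_of_fract_neg_logb_eq_zero hd1 hd9 h0
    refine ⟨hd, -1 - m, ?_⟩
    have := (zpow_eq_mul_ten_zpow_iff ha hd1 (-1) m).2 (by simpa using hm)
    rw [zpow_neg_one, hd, inv_eq_iff_eq_inv] at this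
    rw [this, zpow_sub₀ (by norm_num), mul_inv]
    norm_num
    ring

theorem benfordError_one_of_eq {a : ℝ} (ha : 0 < a) {m : ℤ} (hm : a = 2 * (10 : ℝ) ^ m) (N : ℕ) :
    benfordError 1 (fun n => a ^ n) N = -Int.fract (N * Real.logb 10 a) := by
  have hα := (zpow_eq_mul_ten_zpow_iff ha le_rfl 1 m).1 (by rw [zpow_one, hm]; norm_num)
  rw [benfordError_pow ha le_rfl (by norm_num), rotationDiscrepancy_of_one
    (logb_one_add_pos le_rfl).le (logb_one_add_le_one le_rfl (by norm_num)) (m := m)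
    (by simpa using hα)]
  simp

theorem benfordError_nine_of_eq {a : ℝ} (ha : 0 < a) {m : ℤ} (hm : a = 9 * (10 : ℝ) ^ m) (N : ℕ) :
    benfordError 9 (fun n => a ^ n) N = Int.fract (N * Real.logb 10 a) := by
  have hα := (zpow_eq_mul_ten_zpow_iff ha (d := 9) (by norm_num) (-1) (-1 - m)).1 (by
    rw [zpow_neg_one, hm, zpow_sub₀ (by norm_num), mul_inv]
    norm_num
    ring)
  have hsum := logb_add_logb_one_add (d := 9) (by norm_num)
  have h10 : Real.logb 10 (((9 : ℕ) : ℝ) + 1) = 1 := by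
    norm_num
  rw [h10] at hsum
  rw [benfordError_pow ha (by norm_num) le_rfl, rotationDiscrepancy_of_neg_one
    (logb_one_add_pos (by norm_num)).le (logb_one_add_le_one (by norm_num) le_rfl) (m := -1 - m)
    (by simpa using hα), add_comm, hsum]
  have h1 : Int.fract (-1 : ℝ) = 0 := by
    simp
  -- Here `log₁₀ 9 - α = -m`, so the sawtooth's base point is an integer.
  rw [h1, sub_zero, ← Int.fract_add_intCast (N * Real.logb 10 a) m]
  congr 1
  push_cast at hα hsum ⊢
  linarith

theorem Irrational.hasLimitDensity_fract {α : ℝ} (hα : Irrational α) {σ : ℝ} (hσ : σ ≠ 0)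
    {x : ℕ → ℝ} (hx : ∀ n : ℕ, x n = σ * Int.fract (n * α)) :
    HasLimitDensity x (uniformDensity (min 0 σ) (max 0 σ)) := by
  have hb : ∀ i j : Fin 1, i ≠ j → Irrational ((0 : ℝ) - 0) :=
    fun i j hij => absurd (Subsingleton.elim i j) hij
  have hw : arcLength (fun _ : Fin 1 => (0 : ℝ)) 0 = 1 := by
    simpa using sum_arcLength (b := fun _ : Fin 1 => (0 : ℝ)) hb
  obtain ⟨p, q, hp, hq, -, h⟩ := hα.hasLimitDensity_sawtooth one_ne_zero hb hσ 0 (x := x)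
    fun n => by simp [hx]
  convert h using 2 with y
  simp [hp, hq, hw]

theorem mainTheorem1 (a : ℝ) (ha : 0 < a) (hirr : Irrational (Real.logb 10 a))
    (d : ℕ) (hd1 : 1 ≤ d) (hd9 : d ≤ 9) :
    -- bounded errors
    (HasBoundedBenfordError d (fun n => a ^ n) ↔
      ∃ k m : ℤ, k ≠ 0 ∧ a ^ k = ((d : ℝ) + 1) / (d : ℝ) * (10 : ℝ) ^ m) ∧
    (∀ k m : ℤ, k ≠ 0 → a ^ k = ((d : ℝ) + 1) / (d : ℝ) * (10 : ℝ) ^ m →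
      ∃ f : ℝ → ℝ, IsUniformMixture k.natAbs f ∧
        HasLimitDensity (benfordError d (fun n => a ^ n)) f) ∧
    -- perfect hits
    (IsLowerPerfectHit d (fun n => a ^ n) ↔
      d = 1 ∧ ∃ m : ℤ, a = 2 * (10 : ℝ) ^ m) ∧
    (IsUpperPerfectHit d (fun n => a ^ n) ↔
      d = 9 ∧ ∃ m : ℤ, a = 9 * (10 : ℝ) ^ m) ∧
    -- limit distributions in the case of perfect hits
    ((d = 1 ∧ ∃ m : ℤ, a = 2 * (10 : ℝ) ^ m) →
      HasLimitDensity (benfordError d (fun n => a ^ n)) (uniformDensity (-1) 0)) ∧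
    ((d = 9 ∧ ∃ m : ℤ, a = 9 * (10 : ℝ) ^ m) →
      HasLimitDensity (benfordError d (fun n => a ^ n)) (uniformDensity 0 1)) := by
  have hE := benfordError_pow ha hd1 hd9
  refine ⟨?_, ?_, ⟨isLowerPerfectHit_pow ha hirr hd1 hd9, ?_⟩,
    ⟨isUpperPerfectHit_pow ha hirr hd1 hd9, ?_⟩, ?_, ?_⟩
  · rw [hasBoundedBenfordError_iff ha hirr hd1 hd9]
    simp only [zpow_eq_mul_ten_zpow_iff ha hd1]
    exact ⟨fun ⟨k, m, h⟩ => ⟨k, m, ne_zero_of_mul_eq_logb_one_add hd1 h, h⟩,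
      fun ⟨k, m, _, h⟩ => ⟨k, m, h⟩⟩
  · intro k m hk h
    rw [funext hE]
    exact hirr.exists_uniformMixture_hasLimitDensity (logb_one_add_pos hd1).le
      (logb_one_add_le_one hd1 hd9) hk ((zpow_eq_mul_ten_zpow_iff ha hd1 k m).1 h)
  · rintro ⟨rfl, m, hm⟩
    rw [isLowerPerfectHit_iff]
    intro N
    rw [benfordError_one_of_eq ha hm]
    exact ⟨neg_lt_neg (Int.fract_lt_one _), neg_nonpos.2 (Int.fract_nonneg _)⟩
  · rintro ⟨rfl, m, hm⟩
    rw [isUpperPerfectHit_iff]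
    intro N
    rw [benfordError_nine_of_eq ha hm]
    exact ⟨Int.fract_nonneg _, Int.fract_lt_one _⟩
  · rintro ⟨rfl, m, hm⟩
    have := hirr.hasLimitDensity_fract (σ := -1) (by norm_num) (x := benfordError 1 fun n => a ^ n)
      fun N => by rw [benfordError_one_of_eq ha hm, neg_one_mul]
    simpa using this
  · rintro ⟨rfl, m, hm⟩
    have := hirr.hasLimitDensity_fract (σ := 1) one_ne_zero (x := benfordError 9 fun n => a ^ n)
      fun N => by rw [benfordError_nine_of_eq ha hm, one_mul]
    simpa using this
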